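/- Theorem A.1. A valuation $v$ on a field $F$ (of arbitrary rank) is called Henselian if it has exactly one extension to every algebraic field extension of $F$; valuations with the same valuation ring are identified throughout. A Henselization of $(F,v)$ is a valued field extension $(F_h,v_h)$ of $(F,v)$ such that $v_h$ is Henselian and for every valued field extension $(L,w)$ of $(F,v)$ with $w$ Henselian there is a unique $F$-homomorphism $\eta\colon F_h\to L$ with $v_h=w\circ\eta$. Let $F$ be a field with a valuation $v$, let $K$ be a field extension of $F$ of finite degree, and let $v_1,\dots,v_r$ be all the (distinct) extensions of $v$ to $K$. Let $(F_h,v_h)$ be a Henselization of $(F,v)$, and let $(K_{h,i},v_{i,h})$ be a Henselization of $(K,v_i)$ for $i=1,\dots,r$. Then there is an isomorphism of $K$-algebras $$e\colon K\otimes_F F_h\;\xrightarrow{\ \sim\ }\;K_{h,1}\times\dots\times K_{h,r}$$ such that, for every $i$, the valuation $v_{i,h}$ pulls back to $v_h$ along $F_h\to K_{h,i}$, $c\mapsto e(1\otimes c)_i$. (So $e$ is also an isomorphism of $F_h$-algebras, where $K_{h,i}$ is an $F_h$-algebra through the unique $F$-homomorphism $F_h\to K_{h,i}$ under which $v_{i,h}$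 pulls back to $v_h$.) -/

import Mathlib

open scoped TensorProduct

universe u

namespace Valuation

/-- A valuation `v` on a field `F` is *Henselian* if it has exactly one extension (up to
equivalence, i.e. exactly one extension of its valuation ring) to every algebraic field extension
of `F`. Every algebraic extension of `F : Type u` embeds into `AlgebraicClosure F : Type u`, so
testing extensions in `Type u` is testing all of them. -/
def IsHenselian {F : Type u} [Field F] {Γ : Type*} [LinearOrderedCommGroupWithZero Γ]
    (v : Valuation F Γ) : Prop :=
  ∀ (L : Type u) [Field L] [Algebra F L] [Algebra.IsAlgebraic F L],
    ∃! W : ValuationSubring L, v.HasExtension W.valuation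

/-- `(Fh, vh)` is a *Henselization* of the valued field `(F, v)`: it is a Henselian valued field
extension of `(F, v)`, and for every Henselian valued field extension `(L, w)` of `(F, v)` there is
a unique `F`-homomorphism `η : Fh → L` with `vh = w ∘ η`. Valuations are taken up to equivalence.
Every valuation on `L : Type u` is equivalent to one with value group in `Type u`, namely the
canonical valuation of its valuation ring. -/
structure IsHenselization {F Fh : Type u} [Field F] [Field Fh] [Algebra F Fh]
    {Γ Γh : Type*} [LinearOrderedCommGroupWithZero Γ] [LinearOrderedCommGroupWithZero Γh]
    (v : Valuation F Γ) (vh : Valuation Fh Γh) : Prop where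
  hasExtension : v.HasExtension vh
  isHenselian : vh.IsHenselian
  existsUnique_algHom : ∀ (L : Type u) [Field L] [Algebra F L]
    (Γ' : Type u) [LinearOrderedCommGroupWithZero Γ'] (w : Valuation L Γ'),
    v.HasExtension w → w.IsHenselian →
      ∃! η : Fh →ₐ[F] L, vh.IsEquiv (w.comap (η : Fh →+* L))

/-- The family `w i`, `i : ι`, consists of all the extensions of `v` to `K`, each listed exactly
once, where equivalent valuations are regarded as equal. -/
structure IsListOfExtensions {F K : Type u} [Field F] [Field K] [Algebra F K]
    {Γ : Type*} [LinearOrderedCommGroupWithZero Γ] (v : Valuation F Γ)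
    {ι : Type*} {Γ' : ι → Type*} [∀ i, LinearOrderedCommGroupWithZero (Γ' i)]
    (w : ∀ i, Valuation K (Γ' i)) : Prop where
  hasExtension : ∀ i, v.HasExtension (w i)
  eq_of_isEquiv : ∀ i j, (w i).IsEquiv (w j) → i = j
  exists_isEquiv : ∀ (Δ : Type u) [LinearOrderedCommGroupWithZero Δ] (y : Valuation K Δ),
    v.HasExtension y → ∃ i, y.IsEquiv (w i)

end Valuation

namespace Valuation

/-! ### Extensions of valuations: existence and uniqueness -/

section HasExtension

variable {F : Type*} [Field F] {Γ : Type*} [LinearOrderedCommGroupWithZero Γ]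

/-! `Fh` embeds in a separable closure of `F`, because every valuation there is Henselian. So `K
⊗[F] Fh` is reduced; being finite over `Fh`, it is the product of its residue fields. On each of
these `vh` has a unique extension, which is again Henselian and restricts on `K` to some `w i`;
uniqueness makes `w i` determine and be determined by the maximal ideal. The universal property of
`Kh i` maps it into that residue field, and minimality on both sides makes the two equal
(`exists_algHom_comp_tensorLift_eq`). -/

/-- Chevalley's extension theorem: a valuation extends to every field extension. -/
theorem exists_hasExtension (v : Valuation F Γ) (L : Type*) [Field L] [Algebra F L] :
    ∃ W : ValuationSubring L, v.HasExtension W.valuation := by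
  obtain ⟨W, hle, hloc⟩ :=
    (v.valuationSubring.toLocalSubring.map (algebraMap F L)).exists_le_valuationSubring
  have hmem : ∀ {x : F}, v x ≤ 1 → algebraMap F L x ∈ W := fun {x} hx ↦
    hle (Subring.mem_map.2 ⟨x, hx, rfl⟩)
  refine ⟨W, ⟨isEquiv_iff_val_le_one.2 fun {x} ↦ ⟨fun hx ↦ ?_, fun hx ↦ ?_⟩⟩⟩
  · exact (W.valuation_le_one_iff _).2 (hmem hx)
  · by_contra hlt
    rw [comap_apply, W.valuation_le_one_iff] at hx
    have hx0 : x ≠ 0 := by rintro rfl; simp at hlt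
    have hinv : v x⁻¹ ≤ 1 := by
      rw [map_inv₀]
      exact inv_le_one_of_one_le₀ (not_le.1 hlt).le
    -- `W` dominates the image of the valuation ring of `v`: as `x⁻¹` becomes a unit in `W`, it is
    -- already a unit there, which forces `v x ≤ 1`.
    let y : (v.valuationSubring.toLocalSubring.map (algebraMap F L)).toSubring :=
      ⟨algebraMap F L x⁻¹, Subring.mem_map.2 ⟨x⁻¹, hinv, rfl⟩⟩
    have hy : IsUnit (Subring.inclusion hle y) :=
      IsUnit.of_mul_eq_one (b := ⟨algebraMap F L x, hx⟩) <| Subtype.ext <| by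
        simp [y, Subring.inclusion, hx0]
    obtain ⟨⟨z, hz⟩, hyz⟩ := isUnit_iff_exists_inv.1 (hloc.map_nonunit _ hy)
    obtain ⟨t, ht, rfl⟩ := Subring.mem_map.1 hz
    have hxt : algebraMap F L (x⁻¹ * t) = algebraMap F L 1 := by
      simpa [y] using congr_arg Subtype.val hyz
    have : t = x := by
      have := (algebraMap F L).injective hxt
      field_simp at this
      exact this
    exact hlt (this ▸ ht)

variable {L : Type*} [Field L] [Algebra F L] {Γ' : Type*} [LinearOrderedCommGroupWithZero Γ']

theorem HasExtension.of_isEquiv_right {Δ : Type*} [LinearOrderedCommGroupWithZero Δ]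
    {v : Valuation F Γ} {w : Valuation L Γ'} {w' : Valuation L Δ} (h : v.HasExtension w)
    (hw : w.IsEquiv w') : v.HasExtension w' :=
  ⟨h.val_isEquiv_comap.trans (hw.comap _)⟩

theorem HasExtension.trans {M : Type*} [Field M] [Algebra F M] [Algebra L M]
    [IsScalarTower F L M] {Δ : Type*} [LinearOrderedCommGroupWithZero Δ]
    {v : Valuation F Γ} {w : Valuation L Γ'} {y : Valuation M Δ}
    (h : v.HasExtension w) (h' : w.HasExtension y) : v.HasExtension y := by
  refine ⟨h.val_isEquiv_comap.trans ?_⟩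
  rw [IsScalarTower.algebraMap_eq F L M, comap_comp]
  exact h'.val_isEquiv_comap.comap _

/-- Two extensions of a valuation to a purely inseparable extension coincide. -/
theorem HasExtension.eq_of_isPurelyInseparable [IsPurelyInseparable F L] {v : Valuation F Γ}
    {W W' : ValuationSubring L} (h : v.HasExtension W.valuation)
    (h' : v.HasExtension W'.valuation) : W = W' := by
  have key : ∀ {V : ValuationSubring L}, v.HasExtension V.valuation → ∀ {x : L} {n : ℕ} {a : F},
      n ≠ 0 → algebraMap F L a = x ^ n → (x ∈ V ↔ v a ≤ 1) := by
    intro V hV x n a hn ha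
    rw [← HasExtension.val_map_le_one_iff v V.valuation a, ha, map_pow,
      pow_le_one_iff_of_nonneg zero_le hn, V.valuation_le_one_iff]
  ext x
  -- A power of `x` lies in `F`, so `v` alone decides whether `x` is integral.
  obtain ⟨n, a, ha⟩ := IsPurelyInseparable.pow_mem F (ringExpChar F) x
  have hn : ringExpChar F ^ n ≠ 0 := pow_ne_zero _ (expChar_pos F _).ne'
  rw [key h hn ha, key h' hn ha]

end HasExtension

/-- Every valuation on a separably closed field is Henselian. -/
theorem isHenselian_of_isSepClosed {F : Type u} [Field F] [IsSepClosed F] {Γ : Type*}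
    [LinearOrderedCommGroupWithZero Γ] (v : Valuation F Γ) : v.IsHenselian := by
  intro L _ _ _
  obtain ⟨W, hW⟩ := v.exists_hasExtension L
  exact ⟨W, hW, fun W' hW' ↦ hW'.eq_of_isPurelyInseparable hW⟩

section IsHenselian

variable {F : Type u} [Field F] {Γ : Type*} [LinearOrderedCommGroupWithZero Γ]
  {v : Valuation F Γ}

theorem IsHenselian.of_isEquiv (h : v.IsHenselian) {Δ : Type*} [LinearOrderedCommGroupWithZero Δ]
    {w : Valuation F Δ} (hvw : v.IsEquiv w) : w.IsHenselian := by
  intro L _ _ _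
  obtain ⟨W, hW, huniq⟩ := h L
  exact ⟨W, ⟨hvw.symm.trans hW.val_isEquiv_comap⟩,
    fun W' hW' ↦ huniq W' ⟨hvw.trans hW'.val_isEquiv_comap⟩⟩

variable {L : Type u} [Field L] [Algebra F L] [Algebra.IsAlgebraic F L]

theorem IsHenselian.isEquiv_of_hasExtension (h : v.IsHenselian) {Δ Δ' : Type*}
    [LinearOrderedCommGroupWithZero Δ] [LinearOrderedCommGroupWithZero Δ']
    {w : Valuation L Δ} {w' : Valuation L Δ'} (hw : v.HasExtension w) (hw' : v.HasExtension w') :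
    w.IsEquiv w' :=
  (isEquiv_iff_valuationSubring _ _).2 <| (h L).unique
    (hw.of_isEquiv_right w.isEquiv_valuation_valuationSubring)
    (hw'.of_isEquiv_right w'.isEquiv_valuation_valuationSubring)

/-- The extension of a Henselian valuation to an algebraic extension is Henselian. -/
theorem IsHenselian.of_isAlgebraic (h : v.IsHenselian) {Δ : Type*}
    [LinearOrderedCommGroupWithZero Δ] {w : Valuation L Δ} (hw : v.HasExtension w) :
    w.IsHenselian := by
  intro M _ _ _
  obtain ⟨W, hW⟩ := w.exists_hasExtension M
  let : Algebra F M := ((algebraMap L M).comp (algebraMap F L)).toAlgebra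
  have : IsScalarTower F L M := .of_algebraMap_eq fun _ ↦ rfl
  have : Algebra.IsAlgebraic F M := .trans F L M
  exact ⟨W, hW, fun W' hW' ↦ (h M).unique (hw.trans hW') (hw.trans hW)⟩

end IsHenselian

/-! ### The universal property -/

section IsHenselization

variable {F Fh : Type u} [Field F] [Field Fh] [Algebra F Fh]
  {Γ Γh : Type*} [LinearOrderedCommGroupWithZero Γ] [LinearOrderedCommGroupWithZero Γh]
  {v : Valuation F Γ} {vh : Valuation Fh Γh}

/-- The universal property of a Henselization, for a valuation with values in any universe. -/
theorem IsHenselization.existsUnique_algHom' (h : v.IsHenselization vh) {L : Type u} [Field L]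
    [Algebra F L] {Δ : Type*} [LinearOrderedCommGroupWithZero Δ] (w : Valuation L Δ)
    (hw : v.HasExtension w) (hwh : w.IsHenselian) :
    ∃! η : Fh →ₐ[F] L, vh.IsEquiv (w.comap (η : Fh →+* L)) := by
  have e := w.isEquiv_valuation_valuationSubring
  obtain ⟨η, hη, huniq⟩ := h.existsUnique_algHom L _ w.valuationSubring.valuation
    (hw.of_isEquiv_right e) (hwh.of_isEquiv e)
  exact ⟨η, hη.trans (e.symm.comap _), fun η' hη' ↦ huniq η' (hη'.trans (e.comap _))⟩

theorem IsHenselization.isSeparable (h : v.IsHenselization vh) : Algebra.IsSeparable F Fh := by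
  obtain ⟨W, hW⟩ := v.exists_hasExtension (SeparableClosure F)
  obtain ⟨η, -⟩ := h.existsUnique_algHom' W.valuation hW (isHenselian_of_isSepClosed _)
  exact .of_algHom F _ η

variable {K Kh L : Type u} [Field K] [Field Kh] [Field L] [Algebra F K] [Algebra F Kh]
  [Algebra K Kh] [IsScalarTower F K Kh] [Algebra F L] [Algebra K L] [Algebra Fh L]
  [IsScalarTower F K L] [IsScalarTower F Fh L] {Δ Δh Δ' : Type*}
  [LinearOrderedCommGroupWithZero Δ] [LinearOrderedCommGroupWithZero Δh]
  [LinearOrderedCommGroupWithZero Δ']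

/-- A Henselization of an extension `K` of `F` maps to every algebraic extension `L` of the
Henselization of `F` that contains `K`, compatibly with the valuations. -/
theorem IsHenselization.exists_algHom_comp_eq [Algebra.IsAlgebraic Fh L]
    (h : v.IsHenselization vh) {w : Valuation K Δ} {wh : Valuation Kh Δh}
    (hK : w.IsHenselization wh) {y : Valuation L Δ'} (hy : vh.HasExtension y)
    (hwy : w.HasExtension y) (η : Fh →ₐ[F] Kh) (hη : vh.IsEquiv (wh.comap (η : Fh →+* Kh))) :
    ∃ ψ : Kh →ₐ[K] L, ∀ x, ψ (η x) = algebraMap Fh L x := by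
  have hyh : y.IsHenselian := h.isHenselian.of_isAlgebraic hy
  obtain ⟨ψ, hψ, -⟩ := hK.existsUnique_algHom' y hwy hyh
  refine ⟨ψ, fun x ↦ ?_⟩
  -- Both maps `Fh → L` respect the valuations, so uniqueness identifies them.
  have := (h.existsUnique_algHom' y (h.hasExtension.trans hy) hyh).unique
    (y₁ := (ψ.restrictScalars F).comp η) (y₂ := IsScalarTower.toAlgHom F Fh L)
    (hη.trans (hψ.comap _)) hy.val_isEquiv_comap
  exact DFunLike.congr_fun this x

end IsHenselization

end Valuation

/-- Finitely generated subalgebras are separable field extensions, hence unramified, and so stay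
reduced over an algebraic closure. -/
theorem Algebra.IsSeparable.isGeometricallyReduced (F E : Type*) [Field F] [Field E] [Algebra F E]
    [Algebra.IsSeparable F E] : Algebra.IsGeometricallyReduced F E := by
  refine .of_forall_fg fun B hB ↦ ?_
  have : Algebra.FiniteType F B := B.fg_iff_finiteType.1 hB
  let : Field B := (Subalgebra.isField_of_algebraic B).toField
  have : Algebra.IsSeparable F B := .of_algHom F E B.val
  have : Algebra.FormallyUnramified F B := .of_isSeparable F B
  rw [Algebra.isGeometricallyReduced_field_iff]
  exact Algebra.FormallyUnramified.isReduced_of_field (AlgebraicClosure F) _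

/-- A ring homomorphism from a reduced Artinian ring to a finite product of fields is bijective if
its components are surjective with distinct kernels and every maximal ideal is among these. -/
theorem RingHom.bijective_pi_of_isArtinianRing {R ι : Type*} [CommRing R] [IsArtinianRing R]
    [IsReduced R] [_root_.Finite ι] {S : ι → Type*} [∀ i, Field (S i)] (φ : ∀ i, R →+* S i)
    (hsurj : ∀ i, Function.Surjective (φ i))
    (hinj : ∀ i j, RingHom.ker (φ i) = RingHom.ker (φ j) → i = j)
    (hmax : ∀ m : Ideal R, m.IsMaximal → ∃ i, RingHom.ker (φ i) = m) :
    Function.Bijective (RingHom.pi φ) := by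
  constructor
  · rw [injective_iff_map_eq_zero]
    intro x hx
    have : x ∈ nilradical R := by
      rw [IsArtinianRing.nilradical_eq_iInf, Ideal.mem_iInf]
      intro m
      obtain ⟨i, hi⟩ := hmax m.asIdeal m.isMaximal
      exact hi ▸ congr_fun hx i
    exact (mem_nilradical.1 this).eq_zero
  · intro y
    have hco : Pairwise (Function.onFun IsCoprime fun i ↦ RingHom.ker (φ i)) := fun i j hij ↦
      have := RingHom.ker_isMaximal_of_surjective _ (hsurj i)
      have := RingHom.ker_isMaximal_of_surjective _ (hsurj j)
      Ideal.isCoprime_of_isMaximal (mt (hinj i j) hij)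
    choose z hz using fun i ↦ hsurj i (y i)
    obtain ⟨x, hx⟩ := Ideal.pi_quotient_surjective hco fun i ↦ Ideal.Quotient.mk _ (z i)
    refine ⟨x, funext fun i ↦ ?_⟩
    have := Ideal.Quotient.eq.1 (hx i)
    rw [RingHom.mem_ker, map_sub, sub_eq_zero, hz] at this
    exact this

/-! ### Residue fields of the tensor product -/

section

attribute [local instance] Algebra.TensorProduct.rightAlgebra Ideal.Quotient.field

namespace Valuation

variable {F K Fh Kh : Type u} [Field F] [Field K] [Field Fh] [Field Kh]
  [Algebra F K] [Algebra F Fh] [Algebra K Kh] [Algebra F Kh] [IsScalarTower F K Kh]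
  {Γ Γh Δ Δh : Type*} [LinearOrderedCommGroupWithZero Γ] [LinearOrderedCommGroupWithZero Γh]
  [LinearOrderedCommGroupWithZero Δ] [LinearOrderedCommGroupWithZero Δh]
  {v : Valuation F Γ} {vh : Valuation Fh Γh} {w : Valuation K Δ} {wh : Valuation Kh Δh}

/-- The homomorphism `K ⊗[F] Fh → Kh` given by an `F`-homomorphism `Fh → Kh`. -/
abbrev tensorLift (K : Type u) [Field K] [Algebra F K] [Algebra K Kh] [IsScalarTower F K Kh]
    (η : Fh →ₐ[F] Kh) : K ⊗[F] Fh →ₐ[K] Kh :=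
  Algebra.TensorProduct.lift (Algebra.ofId K Kh) η fun _ _ ↦ .all _ _

variable (m : Ideal (K ⊗[F] Fh))

theorem isAlgebraic_tensorProduct_quotient [FiniteDimensional F K] [m.IsMaximal] :
    Algebra.IsAlgebraic Fh ((K ⊗[F] Fh) ⧸ m) := by
  have : Module.Finite Fh (K ⊗[F] Fh) :=
    .equiv (Algebra.TensorProduct.commRight F Fh K).toLinearEquiv
  have : Module.Finite Fh ((K ⊗[F] Fh) ⧸ m) := inferInstance
  infer_instance

/-- Let `m` be a maximal ideal of `K ⊗[F] Fh`, and suppose that the extension of `vh` to the residue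
field of `m` extends `w`. Then the projection to that residue field factors through `Kh`. -/
theorem IsHenselization.exists_algHom_comp_tensorLift_eq [FiniteDimensional F K] [m.IsMaximal]
    (h : v.IsHenselization vh)
    (hK : w.IsHenselization wh) (η : Fh →ₐ[F] Kh) (hη : vh.IsEquiv (wh.comap (η : Fh →+* Kh)))
    {Δ' : Type*} [LinearOrderedCommGroupWithZero Δ'] {y : Valuation ((K ⊗[F] Fh) ⧸ m) Δ'}
    (hy : vh.HasExtension y) (hwy : w.HasExtension y) :
    ∃ ψ : Kh →ₐ[K] (K ⊗[F] Fh) ⧸ m, ∀ x, ψ (tensorLift K η x) = Ideal.Quotient.mk m x := by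
  have := isAlgebraic_tensorProduct_quotient (F := F) m
  obtain ⟨ψ, hψ⟩ := h.exists_algHom_comp_eq hK hy hwy η hη
  refine ⟨ψ, fun x ↦ ?_⟩
  have : ψ.comp (tensorLift K η) = Ideal.Quotient.mkₐ K m := by
    ext x
    simp only [AlgHom.comp_apply, AlgHom.restrictScalars_apply, tensorLift,
      Algebra.TensorProduct.includeRight_apply, Algebra.TensorProduct.lift_tmul, map_one, one_mul]
    exact hψ x
  exact DFunLike.congr_fun this x

/-- The residue field of the kernel of `K ⊗[F] Fh → Kh` carries a common extension of the valuations
of `Fh` and `K`. -/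
theorem exists_hasExtension_quotient_of_ker_tensorLift_eq (hK : w.HasExtension wh)
    (η : Fh →ₐ[F] Kh) (hη : vh.IsEquiv (wh.comap (η : Fh →+* Kh)))
    (hm : RingHom.ker (tensorLift K η) = m) :
    ∃ y : Valuation ((K ⊗[F] Fh) ⧸ m) Δh, vh.HasExtension y ∧ w.HasExtension y := by
  let j : (K ⊗[F] Fh) ⧸ m →ₐ[K] Kh := Ideal.Quotient.liftₐ m (tensorLift K η) fun a ha ↦ by
    rwa [← hm] at ha
  refine ⟨wh.comap (j : (K ⊗[F] Fh) ⧸ m →+* Kh), ⟨?_⟩, ⟨?_⟩⟩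
  · rw [← comap_comp]
    have : (j : (K ⊗[F] Fh) ⧸ m →+* Kh).comp (algebraMap Fh _) = η := RingHom.ext fun x ↦ by
      change tensorLift K η (1 ⊗ₜ x) = η x
      simp
    rwa [this]
  · rw [← comap_comp]
    rw [j.comp_algebraMap]
    exact hK.val_isEquiv_comap

end Valuation

end

open Valuation in
attribute [local instance] Algebra.TensorProduct.rightAlgebra Ideal.Quotient.field in
/-- If `w i`, `i : ι`, are all the extensions of `v` to a finite extension `K`, then `K ⊗[F] Fh` is
the product of the Henselizations of the `(K, w i)`. -/
theorem Valuation.IsHenselization.bijective_pi_tensorLift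
    {F K Fh : Type u} [Field F] [Field K] [Field Fh]
    [Algebra F K] [FiniteDimensional F K] [Algebra F Fh]
    {Γ Γh : Type*} [LinearOrderedCommGroupWithZero Γ] [LinearOrderedCommGroupWithZero Γh]
    {v : Valuation F Γ} {vh : Valuation Fh Γh} (hFh : v.IsHenselization vh)
    {ι : Type*} [Finite ι] {Γ' : ι → Type*} [∀ i, LinearOrderedCommGroupWithZero (Γ' i)]
    {w : ∀ i, Valuation K (Γ' i)} (hw : v.IsListOfExtensions w)
    {Kh : ι → Type u} [∀ i, Field (Kh i)] [∀ i, Algebra K (Kh i)] [∀ i, Algebra F (Kh i)]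
    [∀ i, IsScalarTower F K (Kh i)]
    {Γh' : ι → Type*} [∀ i, LinearOrderedCommGroupWithZero (Γh' i)]
    {wh : ∀ i, Valuation (Kh i) (Γh' i)} (hKh : ∀ i, (w i).IsHenselization (wh i))
    (η : ∀ i, Fh →ₐ[F] Kh i) (hη : ∀ i, vh.IsEquiv ((wh i).comap (η i : Fh →+* Kh i))) :
    Function.Bijective (AlgHom.pi fun i ↦ tensorLift K (η i)) := by
  have : Algebra.IsSeparable F Fh := hFh.isSeparable
  have := Algebra.IsSeparable.isGeometricallyReduced F Fh
  have : Module.Finite Fh (K ⊗[F] Fh) :=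
    .equiv (Algebra.TensorProduct.commRight F Fh K).toLinearEquiv
  have : IsArtinianRing (K ⊗[F] Fh) := .of_finite Fh _
  have hker : ∀ i, (RingHom.ker (tensorLift K (η i))).IsMaximal := fun i ↦
    (IsArtinianRing.isPrime_iff_isMaximal _).1 (RingHom.ker_isPrime _)
  refine RingHom.bijective_pi_of_isArtinianRing (fun i ↦ (tensorLift K (η i) : K ⊗[F] Fh →+* Kh i))
    (fun i z ↦ ?_)
    (fun i j (hij : RingHom.ker (tensorLift K (η i)) = RingHom.ker (tensorLift K (η j))) ↦ ?_)
    fun m hm ↦ ?_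
  · have := hker i
    obtain ⟨y, hy, hwy⟩ := exists_hasExtension_quotient_of_ker_tensorLift_eq _
      (hKh i).hasExtension (η i) (hη i) rfl
    obtain ⟨ψ, hψ⟩ := hFh.exists_algHom_comp_tensorLift_eq _ (hKh i) (η i) (hη i) hy hwy
    -- The injective `ψ` lets surjectivity of the quotient map descend to `Kh i`.
    obtain ⟨x, hx⟩ := Ideal.Quotient.mk_surjective (ψ z)
    exact ⟨x, ψ.toRingHom.injective ((hψ x).trans hx)⟩
  · have := hker i
    have := isAlgebraic_tensorProduct_quotient (RingHom.ker (tensorLift K (η i)))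
    obtain ⟨y, hy, hwy⟩ := exists_hasExtension_quotient_of_ker_tensorLift_eq _
      (hKh i).hasExtension (η i) (hη i) rfl
    -- With equal kernels, `y` and `y'` live on one residue field and both extend `vh`, so they
    -- agree, also on `K`.
    obtain ⟨y', hy', hwy'⟩ := exists_hasExtension_quotient_of_ker_tensorLift_eq _
      (hKh j).hasExtension (η j) (hη j) hij.symm
    exact hw.eq_of_isEquiv i j <| hwy.val_isEquiv_comap.trans <|
      ((hFh.isHenselian.isEquiv_of_hasExtension hy hy').comap _).trans hwy'.val_isEquiv_comap.symm
  · have := isAlgebraic_tensorProduct_quotient m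
    obtain ⟨W, hW, -⟩ := hFh.isHenselian ((K ⊗[F] Fh) ⧸ m)
    obtain ⟨i, hi⟩ := hw.exists_isEquiv _
      (W.valuation.comap (algebraMap K ((K ⊗[F] Fh) ⧸ m))) <| by
        refine ⟨?_⟩
        rw [← comap_comp, ← IsScalarTower.algebraMap_eq]
        exact (hFh.hasExtension.trans hW).val_isEquiv_comap
    obtain ⟨ψ, hψ⟩ := hFh.exists_algHom_comp_tensorLift_eq m (hKh i) (η i) (hη i) hW ⟨hi.symm⟩
    refine ⟨i, Ideal.ext fun x ↦ ?_⟩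
    rw [← Ideal.Quotient.eq_zero_iff_mem (I := m), ← hψ, map_eq_zero_iff ψ ψ.toRingHom.injective]
    rfl

theorem theoremA1
    {F K Fh : Type u} [Field F] [Field K] [Field Fh]
    [Algebra F K] [FiniteDimensional F K] [Algebra F Fh]
    {Γ Γh : Type*} [LinearOrderedCommGroupWithZero Γ] [LinearOrderedCommGroupWithZero Γh]
    (v : Valuation F Γ) (vh : Valuation Fh Γh) (hFh : v.IsHenselization vh)
    {r : ℕ} {Γ' : Fin r → Type*} [∀ i, LinearOrderedCommGroupWithZero (Γ' i)]
    (w : ∀ i, Valuation K (Γ' i)) (hw : v.IsListOfExtensions w)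
    {Kh : Fin r → Type u} [∀ i, Field (Kh i)] [∀ i, Algebra K (Kh i)]
    {Γh' : Fin r → Type*} [∀ i, LinearOrderedCommGroupWithZero (Γh' i)]
    (wh : ∀ i, Valuation (Kh i) (Γh' i)) (hKh : ∀ i, (w i).IsHenselization (wh i)) :
    ∃ e : K ⊗[F] Fh ≃ₐ[K] (∀ i, Kh i),
      ∀ i, ∀ x y : Fh, vh x ≤ vh y ↔ wh i (e (1 ⊗ₜ[F] x) i) ≤ wh i (e (1 ⊗ₜ[F] y) i) := by
  let (i : Fin r) : Algebra F (Kh i) := ((algebraMap K (Kh i)).comp (algebraMap F K)).toAlgebra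
  have (i : Fin r) : IsScalarTower F K (Kh i) := .of_algebraMap_eq fun _ ↦ rfl
  have hη (i : Fin r) := (hFh.existsUnique_algHom' (wh i)
    ((hw.hasExtension i).trans (hKh i).hasExtension) (hKh i).isHenselian).exists
  choose η hη using hη
  refine ⟨.ofBijective _ (hFh.bijective_pi_tensorLift hw hKh η hη), fun i x y ↦ ?_⟩
  simpa using hη i x y
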